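/- Let $k,l$ be positive integers with $l<k$, let $d=\gcd(l,k)$ and $n=k/d$, and let $c\in\mathrm{GF}(2^d)\subseteq\mathrm{GF}(2^k)$. For $a\in\mathrm{GF}(2^k)$ put \[F_a(x)=a^{2^l}x^{2^{2l}}+x^{2^l}+ax+c,\] and let $N_i$ be the set of all $a\in\mathrm{GF}(2^k)\setminus\{0\}$ such that $F_a$ has exactly $i$ zeros in $\mathrm{GF}(2^k)$. Write $\mathrm{Tr}_d^k(x)=\sum_{i=0}^{k/d-1}x^{2^{id}}$ and $\mathrm{Tr}_k=\mathrm{Tr}_1^k$. Then: (1) For every $a\in\mathrm{GF}(2^k)$, the polynomial $F_a$ has at least one zero in $\mathrm{GF}(2^k)$. (2) If $a\in\mathrm{GF}(2^k)$ is such that $F_a$ has exactly $2^{2d}$ zeros in $\mathrm{GF}(2^k)$, then $\mathrm{Tr}_d^k(v)=nc$ for every $v\in\mathrm{GF}(2^k)$ with $F_a(v)=0$; if moreover $n$ is odd and $c\neq 0$, then \[\sum_{v\in\mathrm{GF}(2^k),\,F_a(v)=0}(-1)^{\mathrm{Tr}_k\left(ac^{-2}v^{2^l+1}\right)}=2^d.\]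 (3) If $n$ is odd then $|N_{2^{2d}}|=\dfrac{2^{k-d}-1}{2^{2d}-1}$, and if $n$ is even then $|N_{2^{2d}}|=\dfrac{2^{k-d}-2^d}{2^{2d}-1}$. -/

import Mathlib

open Polynomial

/-- The trace `Tr_d^k(x) = ∑_{i=0}^{k/d-1} x^(2^(i d))` from `GF(2^k)` to `GF(2^d)`, for `d ∣ k`. -/
def gfTrace {K : Type*} [Field K] (d k : ℕ) (x : K) : K :=
  ∑ i ∈ Finset.range (k / d), x ^ (2 ^ (i * d))

/-- The absolute trace `Tr_k = Tr_1^k`. -/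
def absTrace {K : Type*} [Field K] (k : ℕ) (x : K) : K :=
  gfTrace 1 k x

/-- The sign `(-1)^t` of an element `t` of the prime field `{0, 1}`. -/
def negOnePow {K : Type*} [Field K] [DecidableEq K] (t : K) : ℤ :=
  if t = 0 then 1 else -1

/-- The affine polynomial `F_a(x) = a^(2^l) x^(2^(2l)) + x^(2^l) + a x + c`. -/
noncomputable def affF {K : Type*} [Field K] (l : ℕ) (c a : K) : K[X] :=
  C (a ^ 2 ^ l) * X ^ 2 ^ (2 * l) + X ^ 2 ^ l + C a * X + C c

/-- The set of zeros of `p` in `K`. -/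
noncomputable def zerosIn {K : Type*} [Field K] [Fintype K] [DecidableEq K] (p : K[X]) :
    Finset K :=
  Finset.univ.filter fun v => p.eval v = 0

/-- `N_i`: the set of nonzero `a` for which `F_a` has exactly `i` zeros in `K`. -/
noncomputable def setN {K : Type*} [Field K] [Fintype K] [DecidableEq K] (l : ℕ) (c : K) (i : ℕ) :
    Finset K :=
  Finset.univ.filter fun a => a ≠ 0 ∧ (zerosIn (affF l c a)).card = i

/-- The absolute trace on a field with `2^k` elements takes values in `{0, 1}`. -/
theorem absTrace_eq_zero_or_one {K : Type*} [Field K] [Fintype K] (k : ℕ)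
    (hk : 0 < k) (hK : Fintype.card K = 2 ^ k) (x : K) : absTrace k x = 0 ∨ absTrace k x = 1 := by
  have hc : CharP K 2 := by
    obtain ⟨p, hp⟩ := CharP.exists K
    obtain ⟨m, hpp, hm⟩ := FiniteField.card K p
    have h2 : p ∣ 2 ^ k := by
      rw [← hK, hm]
      exact dvd_pow_self p m.ne_zero
    have h3 : p = 2 := (Nat.prime_dvd_prime_iff_eq hpp Nat.prime_two).1 (hpp.dvd_of_dvd_pow h2)
    exact h3 ▸ hp
  have hsq : absTrace k x ^ 2 = absTrace k x := by
    have hx : x ^ 2 ^ k = x := by rw [← hK]; exact FiniteField.pow_card x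
    unfold absTrace gfTrace
    obtain ⟨m, rfl⟩ := Nat.exists_eq_succ_of_ne_zero hk.ne'
    rw [sum_pow_char]
    simp only [Nat.div_one, mul_one, ← pow_mul, ← pow_succ]
    rw [Finset.sum_range_succ, hx, Finset.sum_range_succ']
    simp
  have h : absTrace k x * (absTrace k x - 1) = 0 := by
    linear_combination hsq
  rcases mul_eq_zero.1 h with h | h
  · exact Or.inl h
  · exact Or.inr (sub_eq_zero.1 h)

/-! Put `σ x = x ^ 2 ^ l`, with fixed field GF(q), q = 2^d. Then `F_a = L + c`, where `L = linPart σ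
a` is GF(q)-linear. Everything rests on an identity: if `L y = 0` and `z = a * y * σ y`, then `σ z +
z = (σ y) ^ 2` (`map_mul_apply_self_add`). Hence kernel elements have trace zero. The trace-form
adjoint of `L` is, up to `σ ^ 2`, an operator of the same shape, so c is orthogonal to its kernel
and a zero exists (`exists_linPart_eq`). If the kernel has q^2 elements, it has a basis u, w with `a
* wronsk σ u w = 1`, and `y ^ 2 = u * w` gives `L y = 1`. The zeros are thus the coset of `c * y`;
its trace is computed in `gfTrace_of_sq`. On it the form in the character sum reduces to the product
f g of coordinates, whose sum is q (`absTrace_quadratic`, `sum_negOnePow_mul`). For the count, each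
such a has (q^2 - 1) q normalised pairs, and (a, u, w) ↦ w / u is a bijection onto the r with `σ (σ
r) ≠ r` (`card_mul_eq`). There are 2^k - 2^gcd(k, 2l) such r, where gcd(k, 2l) = gcd(n, 2) d. -/

/-! ### Identities for solution pairs of a second-order semilinear equation. -/

section Semilinear

variable {K : Type*} [Field K]

/-- The linear part `σ(a) σ²(x) + σ(x) + a x` of `F_a`, for an arbitrary field automorphism `σ`. -/
def linPart (σ : K ≃+* K) (a x : K) : K := σ a * σ (σ x) + σ x + a * x

/-- The Wronskian (Casoratian) `u σ(w) + w σ(u)` in characteristic two. -/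
def wronsk (σ : K ≃+* K) (u w : K) : K := u * σ w + w * σ u

theorem linPart_add (σ : K ≃+* K) (a x y : K) :
    linPart σ a (x + y) = linPart σ a x + linPart σ a y := by
  simp only [linPart, map_add]; ring

theorem linPart_smul (σ : K ≃+* K) (a : K) {f : K} (hf : σ f = f) (x : K) :
    linPart σ a (f * x) = f * linPart σ a x := by
  simp only [linPart, map_mul, hf]; ring

theorem wronsk_comm (σ : K ≃+* K) (u w : K) : wronsk σ u w = wronsk σ w u := by
  simp only [wronsk]; ring

variable [CharP K 2]

/-- Eliminating `σ (σ u)` and `σ (σ w)` by the two equations leaves `a * wronsk σ u w` plus `σ u * σ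
w` twice, which cancels. A nonzero Wronskian can therefore be normalised by a fixed scalar. -/
theorem wronsk_mul_fixed (σ : K ≃+* K) {a u w : K} (hu : linPart σ a u = 0)
    (hw : linPart σ a w = 0) : σ (a * wronsk σ u w) = a * wronsk σ u w := by
  simp only [linPart, wronsk, map_mul, map_add] at *
  have h2 : (2 : K) = 0 := CharTwo.two_eq_zero
  grind

/-- Cramer's rule for a solution pair with normalised Wronskian. -/
theorem eq_of_wronsk (σ : K ≃+* K) {a u w : K} (h : a * wronsk σ u w = 1) (y : K) :
    y = a * wronsk σ u y * w + a * wronsk σ w y * u := by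
  simp only [wronsk] at *
  have h2 : (2 : K) = 0 := CharTwo.two_eq_zero
  grind

theorem wronsk_lin (σ : K ≃+* K) (u w : K) {f g : K} (hf : σ f = f) (hg : σ g = g) :
    wronsk σ u (f * u + g * w) = g * wronsk σ u w := by
  simp only [wronsk, map_mul, map_add, hf, hg]
  have h2 : (2 : K) = 0 := CharTwo.two_eq_zero
  grind

/-- If `y² = u w` for a normalised solution pair `u, w`, then `y` solves the affine equation. -/
theorem linPart_eq_one_of_sq (σ : K ≃+* K) {a u w y : K} (hu : linPart σ a u = 0)
    (hw : linPart σ a w = 0) (h : a * wronsk σ u w = 1) (hy : y ^ 2 = u * w) :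
    linPart σ a y = 1 := by
  have h2 : (2 : K) = 0 := CharTwo.two_eq_zero
  have h1 : σ y ^ 2 = σ u * σ w := by rw [← map_pow, hy, map_mul]
  have h3 : σ (σ y) ^ 2 = σ (σ u) * σ (σ w) := by rw [← map_pow, h1, map_mul]
  have h4 : (linPart σ a y) ^ 2 = 1 ^ 2 := by
    simp only [linPart, wronsk] at *
    grind
  exact CharTwo.sq_injective h4

/-- The triple attached to a parameter `r = w / u`: uniqueness. -/
theorem sq_eq_of_wronsk (σ : K ≃+* K) {a u w r : K} (hu : linPart σ a u = 0)
    (h : a * wronsk σ u w = 1) (hr : w = r * u) :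
    a * (u * σ u) * (r + σ r) = 1 ∧
      σ u ^ 2 = a * (u * σ u) + σ (a * (u * σ u)) := by
  have h2 : (2 : K) = 0 := CharTwo.two_eq_zero
  subst hr
  simp only [linPart, wronsk, map_mul] at *
  constructor <;> grind

/-- If `σ (σ r) = r`, subtracting r times the equation of u from that of `r * u` gives `σ u * (r + σ
r) = 0`, so the Wronskian vanishes. -/
theorem ratio_not_fixed (σ : K ≃+* K) {a u w r : K} (hu : linPart σ a u = 0)
    (hw : linPart σ a w = 0) (h : a * wronsk σ u w = 1) (hr : w = r * u) : σ (σ r) ≠ r := by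
  have h2 : (2 : K) = 0 := CharTwo.two_eq_zero
  intro hfix
  subst hr
  simp only [linPart, wronsk, map_mul, hfix] at *
  have h3 : σ u * (r + σ r) = 0 := by grind
  grind

/-- The triple attached to a parameter `r`: existence. -/
theorem exists_triple (σ : K ≃+* K) (hsq : Function.Surjective fun x : K => x ^ 2) {r : K}
    (hr : σ (σ r) ≠ r) :
    ∃ a u : K, u ≠ 0 ∧ linPart σ a u = 0 ∧ linPart σ a (r * u) = 0 ∧
      a * wronsk σ u (r * u) = 1 := by
  have h2 : (2 : K) = 0 := CharTwo.two_eq_zero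
  have h0 : r + σ r ≠ 0 := fun h => hr (by
    have : σ r = r := by grind
    rw [this, this])
  have h1 : σ r + σ (σ r) ≠ 0 := by
    rw [← map_add]; exact (map_ne_zero σ).2 h0
  -- Forced by `sq_eq_of_wronsk`: with `s = (r + σ r)⁻¹ = a * u * σ u`, one needs `σ u ^ 2 = s + σ
  -- s`.
  obtain ⟨u', hu'⟩ := hsq ((r + σ r)⁻¹ + (σ r + σ (σ r))⁻¹)
  obtain ⟨u, rfl⟩ := σ.surjective u'
  have hu' : σ u ^ 2 = (r + σ r)⁻¹ + (σ r + σ (σ r))⁻¹ := hu'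
  have hu0 : σ u ≠ 0 := by
    intro h
    rw [h] at hu'
    field_simp at hu'
    apply hr
    grind
  have hu1 : u ≠ 0 := fun h => hu0 (by simp [h])
  have hu2 : σ (σ u) ≠ 0 := (map_ne_zero σ).2 hu0
  set s := (r + σ r)⁻¹ with hs
  set t := (σ r + σ (σ r))⁻¹ with ht
  have hs1 : s * (r + σ r) = 1 := inv_mul_cancel₀ h0
  have ht1 : t * (σ r + σ (σ r)) = 1 := inv_mul_cancel₀ h1
  have hst : σ s = t := by rw [hs, map_inv₀, map_add]
  have e1 : s / (u * σ u) * u = s / σ u := by field_simp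
  have e2 : t / (σ u * σ (σ u)) * σ (σ u) = t / σ u := by field_simp
  have hi : σ u * (σ u)⁻¹ = 1 := mul_inv_cancel₀ hu0
  refine ⟨s / (u * σ u), u, hu1, ?_, ?_, ?_⟩
  · simp only [linPart, map_div₀, map_mul, hst, e1, e2]
    field_simp
    grind
  · simp only [linPart, map_div₀, map_mul, hst]
    rw [show s / (u * σ u) * (r * u) = r * (s / (u * σ u) * u) by ring,
      show t / (σ u * σ (σ u)) * (σ (σ r) * σ (σ u))
        = σ (σ r) * (t / (σ u * σ (σ u)) * σ (σ u)) by ring, e1, e2]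
    field_simp
    grind
  · simp only [wronsk, map_mul]
    field_simp
    grind

end Semilinear

/-! ### Bases of the kernel and the double count. -/

section Counting

variable {K : Type*} [Field K] [Fintype K] [DecidableEq K]

/-- The elements fixed by `σ`. -/
def fixedSet (σ : K ≃+* K) : Finset K := Finset.univ.filter fun x => σ x = x

/-- The zeros of `linPart σ a`. -/
def kerSet (σ : K ≃+* K) (a : K) : Finset K := Finset.univ.filter fun x => linPart σ a x = 0

@[simp] theorem mem_fixedSet {σ : K ≃+* K} {x : K} : x ∈ fixedSet σ ↔ σ x = x := by
  simp [fixedSet]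

@[simp] theorem mem_kerSet {σ : K ≃+* K} {a x : K} : x ∈ kerSet σ a ↔ linPart σ a x = 0 := by
  simp [kerSet]

theorem one_lt_card_fixedSet (σ : K ≃+* K) : 1 < (fixedSet σ).card :=
  Finset.one_lt_card.2 ⟨0, by simp, 1, by simp, zero_ne_one⟩

theorem ne_zero_of_card_kerSet {σ : K ≃+* K} {a : K}
    (h : (kerSet σ a).card = (fixedSet σ).card ^ 2) : a ≠ 0 := by
  rintro rfl
  have h1 : kerSet σ 0 = {0} := by
    ext x; simp [linPart]
  have := one_lt_card_fixedSet σ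
  rw [h1, Finset.card_singleton] at h
  nlinarith

variable [CharP K 2]

/-- A normalised solution pair is a basis of the solution space over the fixed field. -/
theorem kerSet_eq_image (σ : K ≃+* K) {a u w : K} (hu : linPart σ a u = 0)
    (hw : linPart σ a w = 0) (h : a * wronsk σ u w = 1) :
    kerSet σ a = (fixedSet σ ×ˢ fixedSet σ).image fun p => p.1 * u + p.2 * w := by
  ext y
  simp only [mem_kerSet, Finset.mem_image, Finset.mem_product, mem_fixedSet, Prod.exists]
  constructor
  · intro hy
    exact ⟨_, _, ⟨wronsk_mul_fixed σ hw hy, wronsk_mul_fixed σ hu hy⟩,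
      by rw [add_comm]; exact (eq_of_wronsk σ h y).symm⟩
  · rintro ⟨f, g, ⟨hf, hg⟩, rfl⟩
    rw [linPart_add, linPart_smul σ a hf, linPart_smul σ a hg, hu, hw]
    simp

theorem injOn_combination (σ : K ≃+* K) {a u w : K} (h : a * wronsk σ u w = 1) :
    Set.InjOn (fun p : K × K => p.1 * u + p.2 * w) (fixedSet σ ×ˢ fixedSet σ : Finset (K × K)) := by
  rintro ⟨f, g⟩ hp ⟨f', g'⟩ hp' he
  simp only [Finset.coe_product, Set.mem_prod, Finset.mem_coe, mem_fixedSet] at hp hp' he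
  have h1 := wronsk_lin σ u w hp.1 hp.2
  have h2 := wronsk_lin σ w u hp.2 hp.1
  rw [he, wronsk_lin σ u w hp'.1 hp'.2] at h1
  rw [add_comm, he, add_comm, wronsk_lin σ w u hp'.2 hp'.1] at h2
  have hW : wronsk σ u w ≠ 0 := right_ne_zero_of_mul_eq_one h
  have hW' : wronsk σ w u ≠ 0 := by rwa [wronsk_comm]
  exact Prod.ext (mul_right_cancel₀ hW' h2).symm (mul_right_cancel₀ hW h1).symm

theorem card_kerSet_of_pair (σ : K ≃+* K) {a u w : K} (hu : linPart σ a u = 0)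
    (hw : linPart σ a w = 0) (h : a * wronsk σ u w = 1) :
    (kerSet σ a).card = (fixedSet σ).card ^ 2 := by
  rw [kerSet_eq_image σ hu hw h, Finset.card_image_of_injOn (injOn_combination σ h),
    Finset.card_product, sq]

/-- Elements with vanishing Wronskian are proportional over the fixed field. -/
theorem exists_fixed_mul_of_wronsk_eq_zero (σ : K ≃+* K) {u w : K} (hu : u ≠ 0)
    (h : wronsk σ u w = 0) : ∃ f ∈ fixedSet σ, w = f * u := by
  refine ⟨w / u, ?_, by field_simp⟩
  have h2 : (2 : K) = 0 := CharTwo.two_eq_zero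
  have hu' : σ u ≠ 0 := (map_ne_zero σ).2 hu
  rw [mem_fixedSet, map_div₀]
  field_simp
  simp only [wronsk] at h
  grind

/-- Were all Wronskians with u zero, the kernel would be a line over the fixed field, too small to
have q^2 elements. -/
theorem exists_pair_of_card (σ : K ≃+* K) {a u : K}
    (h : (kerSet σ a).card = (fixedSet σ).card ^ 2) (hu : linPart σ a u = 0) (hu0 : u ≠ 0) :
    ∃ w, linPart σ a w = 0 ∧ a * wronsk σ u w = 1 := by
  have ha := ne_zero_of_card_kerSet h
  obtain ⟨w, hw, hW⟩ : ∃ w, linPart σ a w = 0 ∧ wronsk σ u w ≠ 0 := by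
    by_contra! hcon
    have hsub : kerSet σ a ⊆ (fixedSet σ).image fun f => f * u := by
      intro w hw
      obtain ⟨f, hf, rfl⟩ :=
        exists_fixed_mul_of_wronsk_eq_zero σ hu0 (hcon w (mem_kerSet.1 hw))
      exact Finset.mem_image_of_mem _ hf
    have := (Finset.card_le_card hsub).trans Finset.card_image_le
    have := one_lt_card_fixedSet σ
    nlinarith
  have hfix := wronsk_mul_fixed σ hu hw
  set f := a * wronsk σ u w with hf
  have hf0 : f ≠ 0 := mul_ne_zero ha hW
  have hfi : σ f⁻¹ = f⁻¹ := by rw [map_inv₀, hfix]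
  refine ⟨f⁻¹ * w, by rw [linPart_smul σ a hfi, hw, mul_zero], ?_⟩
  have : wronsk σ u (f⁻¹ * w) = f⁻¹ * wronsk σ u w := by
    simp only [wronsk, map_mul, hfi]; ring
  rw [this, mul_left_comm, ← hf, inv_mul_cancel₀ hf0]

theorem exists_pair (σ : K ≃+* K) {a : K} (h : (kerSet σ a).card = (fixedSet σ).card ^ 2) :
    ∃ u w, linPart σ a u = 0 ∧ linPart σ a w = 0 ∧ a * wronsk σ u w = 1 := by
  have h1 : 1 < (kerSet σ a).card := by
    rw [h]
    have := one_lt_card_fixedSet σ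
    nlinarith
  obtain ⟨u, hu, hu0⟩ := Finset.exists_mem_ne h1 0
  obtain ⟨w, hw⟩ := exists_pair_of_card σ h (mem_kerSet.1 hu) hu0
  exact ⟨u, w, mem_kerSet.1 hu, hw⟩

/-- The number of normalised partners of a nonzero solution. -/
theorem card_partners (σ : K ≃+* K) {a u : K}
    (h : (kerSet σ a).card = (fixedSet σ).card ^ 2) (hu : linPart σ a u = 0) (hu0 : u ≠ 0) :
    (Finset.univ.filter fun w => linPart σ a w = 0 ∧ a * wronsk σ u w = 1).card
      = (fixedSet σ).card := by
  have ha := ne_zero_of_card_kerSet h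
  obtain ⟨w₀, hw₀, hW⟩ := exists_pair_of_card σ h hu hu0
  have himg : (Finset.univ.filter fun w => linPart σ a w = 0 ∧ a * wronsk σ u w = 1)
      = (fixedSet σ).image fun f => f * u + w₀ := by
    ext w
    simp only [Finset.mem_filter, Finset.mem_univ, true_and, Finset.mem_image]
    constructor
    · rintro ⟨-, h1⟩
      have h0 : wronsk σ u (w - w₀) = 0 := by
        have : a * wronsk σ u (w - w₀) = 0 := by
          have h3 : a * wronsk σ u (w - w₀) = a * wronsk σ u w - a * wronsk σ u w₀ := by
            simp only [wronsk, map_sub]; ring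
          rw [h3, h1, hW, sub_self]
        exact (mul_eq_zero.1 this).resolve_left ha
      obtain ⟨f, hf, hfe⟩ := exists_fixed_mul_of_wronsk_eq_zero σ hu0 h0
      exact ⟨f, hf, by rw [← hfe]; ring⟩
    · rintro ⟨f, hf, rfl⟩
      rw [mem_fixedSet] at hf
      refine ⟨by rw [linPart_add, linPart_smul σ a hf, hu, hw₀]; simp, ?_⟩
      have := wronsk_lin σ u w₀ hf (map_one σ)
      rw [one_mul, one_mul] at this
      rw [this, hW]
  rw [himg, Finset.card_image_of_injective]
  intro f g hfg
  exact mul_right_cancel₀ hu0 (add_right_cancel hfg)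

/-- Double counting of triples `(a, u, w)`, parametrised by the ratio `w / u`. -/
theorem card_mul_eq (σ : K ≃+* K) :
    (Finset.univ.filter fun a => (kerSet σ a).card = (fixedSet σ).card ^ 2).card
        * (((fixedSet σ).card ^ 2 - 1) * (fixedSet σ).card)
      = (Finset.univ.filter fun r : K => σ (σ r) ≠ r).card := by
  have hsq : Function.Surjective fun x : K => x ^ 2 :=
    Finite.surjective_of_injective CharTwo.sq_injective
  set S : Finset (Σ _ : K, Σ _ : K, K) :=
    (Finset.univ.filter fun a => (kerSet σ a).card = (fixedSet σ).card ^ 2).sigma fun a =>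
      ((kerSet σ a).erase 0).sigma fun u =>
        Finset.univ.filter fun w => linPart σ a w = 0 ∧ a * wronsk σ u w = 1 with hS
  have hcard : S.card = (Finset.univ.filter fun a =>
      (kerSet σ a).card = (fixedSet σ).card ^ 2).card
        * (((fixedSet σ).card ^ 2 - 1) * (fixedSet σ).card) := by
    rw [hS, Finset.card_sigma, Finset.sum_const_nat]
    intro a ha
    have ha' := (Finset.mem_filter.1 ha).2
    rw [Finset.card_sigma, Finset.sum_const_nat (m := (fixedSet σ).card),
      Finset.card_erase_of_mem (by simp [linPart]), ha']
    intro u hu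
    rw [Finset.mem_erase, mem_kerSet] at hu
    exact card_partners σ ha' hu.2 hu.1
  rw [← hcard]
  refine Finset.card_bij (fun p _ => p.2.2 / p.2.1) ?_ ?_ ?_
  · rintro ⟨a, u, w⟩ hp
    simp only [hS, Finset.mem_sigma, Finset.mem_filter, Finset.mem_univ, true_and,
      Finset.mem_erase, mem_kerSet] at hp ⊢
    obtain ⟨-, ⟨hu0, hu⟩, hw, hW⟩ := hp
    exact ratio_not_fixed σ hu hw hW (by field_simp)
  · rintro ⟨a, u, w⟩ hp ⟨a', u', w'⟩ hp' he
    simp only [hS, Finset.mem_sigma, Finset.mem_filter, Finset.mem_univ, true_and,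
      Finset.mem_erase, mem_kerSet] at hp hp' he
    obtain ⟨-, ⟨hu0, hu⟩, hw, hW⟩ := hp
    obtain ⟨-, ⟨hu0', hu'⟩, hw', hW'⟩ := hp'
    set r := w / u with hr
    have hwr : w = r * u := by rw [hr]; field_simp
    have hwr' : w' = r * u' := by rw [he]; field_simp
    obtain ⟨h1, h2⟩ := sq_eq_of_wronsk σ hu hW hwr
    obtain ⟨h1', h2'⟩ := sq_eq_of_wronsk σ hu' hW' hwr'
    have hz : a * (u * σ u) = a' * (u' * σ u') :=
      mul_right_cancel₀ (right_ne_zero_of_mul_eq_one h1) (h1.trans h1'.symm)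
    have huu : u = u' := by
      apply σ.injective
      apply CharTwo.sq_injective
      show σ u ^ 2 = σ u' ^ 2
      rw [h2, h2', hz]
    subst huu
    have haa : a = a' := mul_right_cancel₀ (mul_ne_zero hu0 ((map_ne_zero σ).2 hu0)) hz
    subst haa
    rw [hwr, hwr']
  · intro r hr
    obtain ⟨a, u, hu0, hu, hw, hW⟩ := exists_triple σ hsq (Finset.mem_filter.1 hr).2
    refine ⟨⟨a, u, r * u⟩, ?_, by simp [hu0]⟩
    simp only [hS, Finset.mem_sigma, Finset.mem_filter, Finset.mem_univ, true_and,
      Finset.mem_erase, mem_kerSet]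
    exact ⟨card_kerSet_of_pair σ hu hw hW, ⟨hu0, hu⟩, hw, hW⟩

end Counting

/-! ### Traces, fixed points of Frobenius powers, and duality. -/

section Trace

variable {K : Type*} [Field K]

theorem charP_two_of_card [Fintype K] {k : ℕ} (hK : Fintype.card K = 2 ^ k) : CharP K 2 :=
  charP_of_card_eq_prime_pow hK

/-- The number of solutions of `x ^ 2 ^ m = x` in a field with `2 ^ k` elements. -/
theorem card_pow_eq_self [Fintype K] [DecidableEq K] {k m : ℕ} (hK : Fintype.card K = 2 ^ k) :
    (Finset.univ.filter fun x : K => x ^ 2 ^ m = x).card = 2 ^ Nat.gcd k m := by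
  have h1 : (Finset.univ.filter fun x : K => x ^ 2 ^ m = x)
      = insert 0 ((Finset.univ.filter fun y : Kˣ => y ∈ (powMonoidHom (2 ^ m - 1) : Kˣ →* Kˣ).ker).image
        fun y : Kˣ => (y : K)) := by
    have hp : 2 ^ m = (2 ^ m - 1) + 1 := (Nat.sub_add_cancel Nat.one_le_two_pow).symm
    ext x
    simp only [Finset.mem_filter, Finset.mem_univ, true_and, Finset.mem_insert, Finset.mem_image,
      MonoidHom.mem_ker, powMonoidHom_apply]
    constructor
    · intro hx
      by_cases h0 : x = 0
      · exact Or.inl h0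
      · refine Or.inr ⟨Units.mk0 x h0, ?_, rfl⟩
        rw [hp, pow_succ] at hx
        ext
        exact mul_right_cancel₀ h0 (by simpa using hx)
    · rintro (rfl | ⟨y, hy, rfl⟩)
      · simp
      · rw [hp, pow_succ, ← Units.val_pow_eq_pow_val, hy]
        simp
  rw [h1, Finset.card_insert_of_notMem (by simp), Finset.card_image_of_injective _ Units.val_injective,
    ← Fintype.card_subtype, ← Nat.card_eq_fintype_card]
  -- In the cyclic unit group this kernel has gcd(2^k - 1, 2^m - 1) = 2^gcd(k, m) - 1 elements; zero
  -- supplies the missing one.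
  have h2 := IsCyclic.card_powMonoidHom_ker Kˣ (2 ^ m - 1)
  have h3 : Nat.card Kˣ = 2 ^ k - 1 := by
    rw [Nat.card_eq_fintype_card, Fintype.card_units, hK]
  rw [h3, Nat.pow_sub_one_gcd_pow_sub_one] at h2
  have h4 : 1 ≤ 2 ^ Nat.gcd k m := Nat.one_le_two_pow
  exact (congrArg (· + 1) h2).trans (Nat.sub_add_cancel h4)

theorem gfTrace_fixed_mul (d k : ℕ) {f : K} (hf : f ^ 2 ^ d = f) (x : K) :
    gfTrace d k (f * x) = f * gfTrace d k x := by
  have h : ∀ i : ℕ, f ^ 2 ^ (i * d) = f := by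
    intro i
    induction i with
    | zero => simp
    | succ i ih => rw [add_mul, one_mul, pow_add, pow_mul, ih, hf]
  simp only [gfTrace, mul_pow, h, Finset.mul_sum]

theorem gfTrace_one (d k : ℕ) : gfTrace d k (1 : K) = ((k / d : ℕ) : K) := by
  simp [gfTrace]

theorem gfTrace_zero (d k : ℕ) : gfTrace d k (0 : K) = 0 := by
  simp [gfTrace]

theorem algebraMap_trace_eq_absTrace [Fintype K] [Algebra (ZMod 2) K] {k : ℕ}
    (hK : Fintype.card K = 2 ^ k) (x : K) :
    algebraMap (ZMod 2) K (Algebra.trace (ZMod 2) K x) = absTrace k x := by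
  have hr : Module.finrank (ZMod 2) K = k := by
    have := Module.card_eq_pow_finrank (K := ZMod 2) (V := K)
    rw [hK, ZMod.card] at this
    exact (Nat.pow_right_injective le_rfl this).symm
  rw [FiniteField.algebraMap_trace_eq_sum_pow, hr]
  simp [absTrace, gfTrace]

variable [CharP K 2]

theorem gfTrace_add (d k : ℕ) (x y : K) : gfTrace d k (x + y) = gfTrace d k x + gfTrace d k y := by
  simp only [gfTrace, add_pow_char_pow, Finset.sum_add_distrib]

theorem gfTrace_pow (d k m : ℕ) (x : K) : gfTrace d k (x ^ 2 ^ m) = gfTrace d k x ^ 2 ^ m := by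
  simp only [gfTrace, sum_pow_char_pow, ← pow_mul, mul_comm]

theorem gfTrace_pow_self [Fintype K] {d k : ℕ} (hK : Fintype.card K = 2 ^ k) (hd : d ∣ k) (x : K) :
    gfTrace d k x ^ 2 ^ d = gfTrace d k x := by
  rw [← gfTrace_pow]
  have h : x ^ 2 ^ (k / d * d) = x := by
    rw [Nat.div_mul_cancel hd, ← hK, FiniteField.pow_card]
  simp only [gfTrace, ← pow_mul, ← pow_add]
  have h' := Finset.sum_range_succ (fun i => x ^ 2 ^ (i * d)) (k / d)
  rw [Finset.sum_range_succ', h] at h'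
  simp only [zero_mul, pow_zero, pow_one] at h'
  rw [← add_right_cancel h']
  exact Finset.sum_congr rfl fun i _ => by ring_nf

theorem gfTrace_pow_of_dvd [Fintype K] {d k l : ℕ} (hK : Fintype.card K = 2 ^ k) (hd : d ∣ k)
    (hl : d ∣ l) (x : K) : gfTrace d k (x ^ 2 ^ l) = gfTrace d k x := by
  obtain ⟨m, rfl⟩ := hl
  rw [gfTrace_pow]
  induction m with
  | zero => simp
  | succ m ih => rw [Nat.mul_succ, pow_add, pow_mul, ih, gfTrace_pow_self hK hd]

theorem absTrace_add (k : ℕ) (x y : K) : absTrace k (x + y) = absTrace k x + absTrace k y :=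
  gfTrace_add 1 k x y

theorem absTrace_pow [Fintype K] {k : ℕ} (hK : Fintype.card K = 2 ^ k) (l : ℕ) (x : K) :
    absTrace k (x ^ 2 ^ l) = absTrace k x :=
  gfTrace_pow_of_dvd hK (one_dvd k) (one_dvd l) x

theorem absTrace_sq [Fintype K] {k : ℕ} (hK : Fintype.card K = 2 ^ k) (x : K) :
    absTrace k (x ^ 2) = absTrace k x := by
  simpa using absTrace_pow hK 1 x

theorem exists_absTrace_eq_one [Fintype K] {k : ℕ} (hK : Fintype.card K = 2 ^ k) :
    ∃ x : K, absTrace k x = 1 := by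
  let _ := ZMod.algebra K 2
  obtain ⟨x, hx⟩ := Algebra.trace_surjective (ZMod 2) K 1
  exact ⟨x, by rw [← algebraMap_trace_eq_absTrace hK, hx, map_one]⟩

theorem eq_zero_of_absTrace_mul [Fintype K] {k : ℕ} (hK : Fintype.card K = 2 ^ k) {y : K}
    (h : ∀ x, absTrace k (y * x) = 0) : y = 0 := by
  by_contra hy
  obtain ⟨x, hx⟩ := exists_absTrace_eq_one hK
  have := h (y⁻¹ * x)
  rw [mul_inv_cancel_left₀ hy, hx] at this
  exact one_ne_zero this

/-- An additive endomorphism attains every value orthogonal, under the absolute trace form, to the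
orthogonal complement of its range. -/
theorem exists_preimage_of_absTrace [Fintype K] {k : ℕ} (hK : Fintype.card K = 2 ^ k)
    (f : K →+ K) (c : K)
    (h : ∀ y, (∀ x, absTrace k (y * f x) = 0) → absTrace k (y * c) = 0) : ∃ x, f x = c := by
  let _ := ZMod.algebra K 2
  by_contra hc
  have hc' : c ∉ LinearMap.range (f.toZModLinearMap 2) := by
    rintro ⟨x, hx⟩
    exact hc ⟨x, hx⟩
  obtain ⟨g, hg, hgf⟩ := Submodule.exists_dual_map_eq_bot_of_notMem hc' inferInstance
  obtain ⟨y, rfl⟩ := (LinearMap.BilinForm.toDual (Algebra.traceForm (ZMod 2) K)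
    (traceForm_nondegenerate (ZMod 2) K)).surjective g
  have hy : ∀ x, algebraMap (ZMod 2) K (LinearMap.BilinForm.toDual (Algebra.traceForm (ZMod 2) K)
      (traceForm_nondegenerate (ZMod 2) K) y x) = absTrace k (y * x) := by
    intro x
    rw [LinearMap.BilinForm.toDual_def, Algebra.traceForm_apply, algebraMap_trace_eq_absTrace hK]
  apply hg
  apply (algebraMap (ZMod 2) K).injective
  rw [hy, map_zero]
  refine h y fun x => ?_
  rw [← hy]
  have hx : LinearMap.BilinForm.toDual (Algebra.traceForm (ZMod 2) K)
      (traceForm_nondegenerate (ZMod 2) K) y (f x) = 0 := by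
    exact (Submodule.eq_bot_iff _).1 hgf _ (Submodule.mem_map_of_mem ⟨x, rfl⟩)
  rw [hx, map_zero]

end Trace

/-! ### Solvability, traces of zeros, and the character sum. -/

section Affine

variable {K : Type*} [Field K] [CharP K 2]

theorem eval_affF [Fintype K] (l : ℕ) (c a v : K) :
    (affF l c a).eval v = linPart (iterateFrobeniusEquiv K 2 l) a v + c := by
  simp only [affF, linPart, iterateFrobeniusEquiv_def, eval_add, eval_mul, eval_C, eval_pow, eval_X,
    ← pow_mul, ← pow_add, two_mul]

theorem card_fixedSet_iterateFrobeniusEquiv [Fintype K] [DecidableEq K] {k l : ℕ} (hK : Fintype.card K = 2 ^ k) :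
    (fixedSet (iterateFrobeniusEquiv K 2 l)).card = 2 ^ Nat.gcd k l := by
  simp only [fixedSet, iterateFrobeniusEquiv_def]
  exact card_pow_eq_self hK

theorem map_mul_apply_self_add (σ : K ≃+* K) {a y : K} (hy : linPart σ a y = 0) :
    σ (a * (y * σ y)) + a * (y * σ y) = σ y ^ 2 := by
  have h2 : (2 : K) = 0 := CharTwo.two_eq_zero
  simp only [linPart, map_mul] at *
  grind

theorem exists_linPart_eq [Fintype K] {k : ℕ} (hK : Fintype.card K = 2 ^ k) (σ : K ≃+* K)
    (hσ : ∀ x, absTrace k (σ x) = absTrace k x) {c : K} (hc : σ c = c) (a : K) :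
    ∃ v, linPart σ a v = c := by
  have h2 : (2 : K) = 0 := CharTwo.two_eq_zero
  refine exists_preimage_of_absTrace hK (AddMonoidHom.mk' (linPart σ a) (linPart_add σ a)) c ?_
  intro y hy
  simp only [AddMonoidHom.mk'_apply] at hy
  -- The adjoint of `linPart σ a` kills y; applying `σ` twice turns this into `linPart σ (σ a) y =
  -- 0`.
  have hadj : σ.symm (σ.symm (y * σ a)) + σ.symm y + a * y = 0 := by
    apply eq_zero_of_absTrace_mul hK
    intro x
    have e1 : absTrace k (σ.symm (σ.symm (y * σ a)) * x) = absTrace k (y * σ a * σ (σ x)) := by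
      rw [← hσ, ← hσ]; simp
    have e2 : absTrace k (σ.symm y * x) = absTrace k (y * σ x) := by
      rw [← hσ]; simp
    rw [add_mul, add_mul, absTrace_add, absTrace_add, e1, e2, ← absTrace_add, ← absTrace_add, ← hy x]
    congr 1
    simp only [linPart]; ring
  have hL : linPart σ (σ a) y = 0 := by
    have := congrArg (fun t => σ (σ t)) hadj
    simp only [map_add, map_mul, RingEquiv.apply_symm_apply, map_zero] at this
    simp only [linPart]
    linear_combination this
  have hz := map_mul_apply_self_add σ hL
  set z := σ a * (y * σ y)
  have h3 : (σ (y * c)) ^ 2 = σ (c ^ 2 * z) + c ^ 2 * z := by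
    rw [map_mul, map_mul, map_pow, hc]
    linear_combination -(c ^ 2) * hz
  rw [← hσ, ← absTrace_sq hK, h3, absTrace_add, hσ, CharTwo.add_self_eq_zero]

theorem gfTrace_eq_zero_of_linPart {d k : ℕ} (σ : K ≃+* K)
    (hσ : ∀ x, gfTrace d k (σ x) = gfTrace d k x) {a y : K} (hy : linPart σ a y = 0) :
    gfTrace d k y = 0 := by
  have h := congrArg (gfTrace d k) (map_mul_apply_self_add σ hy)
  have h1 := gfTrace_pow d k 1 (σ y)
  rw [pow_one] at h1
  rw [gfTrace_add, hσ, CharTwo.add_self_eq_zero, h1, hσ] at h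
  exact pow_eq_zero_iff two_ne_zero |>.1 h.symm

/-- Multiplying the equation of u by `σ w` splits `σ (u * w)` into two terms which, up to `σ`, are
the halves of the normalised Wronskian. So `u * w` has trace n, and n is its own square root in
characteristic two. -/
theorem gfTrace_of_sq {d k : ℕ} (σ : K ≃+* K)
    (hσ : ∀ x, gfTrace d k (σ x) = gfTrace d k x) {a u w y : K} (hu : linPart σ a u = 0)
    (h : a * wronsk σ u w = 1) (hy : y ^ 2 = u * w) :
    gfTrace d k y = ((k / d : ℕ) : K) := by
  have h2 : (2 : K) = 0 := CharTwo.two_eq_zero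
  have e1 : σ (u * w) = σ (a * (w * σ u)) + a * (u * σ w) := by
    simp only [linPart, map_mul] at *
    grind
  have e2 : a * (w * σ u) + a * (u * σ w) = 1 := by
    rw [← h, wronsk]; ring
  have e3 : gfTrace d k (u * w) = ((k / d : ℕ) : K) := by
    rw [← hσ, e1, gfTrace_add, hσ, ← gfTrace_add, e2, gfTrace_one]
  have e4 : ((k / d : ℕ) : K) ^ 2 = ((k / d : ℕ) : K) := by
    rcases Nat.even_or_odd (k / d) with he | ho
    · rw [(CharP.cast_eq_zero_iff K 2 _).2 he.two_dvd]; simp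
    · obtain ⟨m, hm⟩ := ho
      rw [hm]; push_cast; rw [h2]; ring
  have h1 := gfTrace_pow d k 1 y
  rw [pow_one, hy, e3] at h1
  apply CharTwo.sq_injective
  show gfTrace d k y ^ 2 = ((k / d : ℕ) : K) ^ 2
  rw [← h1, e4]

/-- The quadratic form `a v σ(v)` on the affine solution space, up to terms of trace zero. -/
theorem absTrace_quadratic [Fintype K] {k : ℕ} (hK : Fintype.card K = 2 ^ k) (σ : K ≃+* K)
    {a u w y f g : K} (h : a * wronsk σ u w = 1) (hy : y ^ 2 = u * w)
    (hf : σ f = f) (hg : σ g = g) :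
    absTrace k (a * ((y + (f * u + g * w)) * σ (y + (f * u + g * w)))) = absTrace k (f * g) := by
  have h2 : (2 : K) = 0 := CharTwo.two_eq_zero
  have hsq : Function.Surjective fun x : K => x ^ 2 :=
    Finite.surjective_of_injective CharTwo.sq_injective
  obtain ⟨A, hA⟩ := hsq (a * (u * σ u))
  obtain ⟨B, hB⟩ := hsq (a * (w * σ w))
  simp only at hA hB
  have hy' : σ y ^ 2 = σ u * σ w := by rw [← map_pow, hy, map_mul]
  have hAu : a * (u * σ y + y * σ u) = A := by
    apply CharTwo.sq_injective
    simp only [wronsk] at *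
    grind
  have hBw : a * (w * σ y + y * σ w) = B := by
    apply CharTwo.sq_injective
    simp only [wronsk] at *
    grind
  have hAB : a * (y * σ y) = A * B := by
    apply CharTwo.sq_injective
    simp only [wronsk] at *
    grind
  -- With `t = a * (w * σ u)` the normalisation gives `a * (u * σ w) = t + 1`, so this is `t * (t +
  -- 1)`, of trace zero.
  have hm : (A * B) ^ 2 = (a * (w * σ u)) ^ 2 + a * (w * σ u) := by
    simp only [wronsk] at *
    grind
  have hAB0 : absTrace k (A * B) = 0 := by
    rw [← absTrace_sq hK, hm, absTrace_add, absTrace_sq hK, CharTwo.add_self_eq_zero]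
  have hexp : a * ((y + (f * u + g * w)) * σ (y + (f * u + g * w)))
      = A * B + (f * A + (f * A) ^ 2) + (g * B + (g * B) ^ 2) + f * g := by
    simp only [map_add, map_mul, hf, hg]
    simp only [wronsk] at h
    linear_combination hAB + f * hAu + g * hBw + f * g * h - f ^ 2 * hA - g ^ 2 * hB
  rw [hexp]
  simp only [absTrace_add, absTrace_sq hK, hAB0, CharTwo.add_self_eq_zero, zero_add]

theorem negOnePow_add_one [DecidableEq K] {t : K} (ht : t = 0 ∨ t = 1) : negOnePow t + negOnePow (t + 1) = 0 := by
  rcases ht with rfl | rfl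
  · simp [negOnePow]
  · simp [negOnePow, CharTwo.add_self_eq_zero]

theorem absTrace_gfTrace_of_odd [Fintype K] {d k : ℕ} (hK : Fintype.card K = 2 ^ k) (hn : Odd (k / d)) (y : K) :
    absTrace k (gfTrace d k y) = absTrace k y := by
  have h := map_sum (AddMonoidHom.mk' (absTrace (K := K) k) (absTrace_add k))
    (fun i => y ^ 2 ^ (i * d)) (Finset.range (k / d))
  simp only [AddMonoidHom.mk'_apply, absTrace_pow hK, Finset.sum_const, Finset.card_range,
    nsmul_eq_mul] at h
  obtain ⟨m, hm⟩ := hn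
  have h1 : ((k / d : ℕ) : K) = 1 := by
    rw [hm]; push_cast; rw [CharTwo.two_eq_zero]; ring
  rw [h1, one_mul] at h
  exact h

/-- The character sum of the bilinear form `(f, g) ↦ f g` over a subfield of odd codegree. -/
theorem sum_negOnePow_mul [Fintype K] [DecidableEq K] {d k : ℕ} (hk : 0 < k) (hK : Fintype.card K = 2 ^ k) (hd : d ∣ k)
    (hn : Odd (k / d)) (F : Finset K) (hF : ∀ x, x ∈ F ↔ x ^ 2 ^ d = x) :
    ∑ p ∈ F ×ˢ F, negOnePow (absTrace k (p.1 * p.2)) = F.card := by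
  have h0 : (0 : K) ∈ F := by rw [hF]; simp
  rw [Finset.sum_product_right, Finset.sum_eq_single_of_mem 0 h0]
  · simp [negOnePow, absTrace, gfTrace_zero]
  · intro g hg hg0
    obtain ⟨y, hy⟩ := exists_absTrace_eq_one hK
    -- Since k / d is odd, `e * g` has absolute trace 1, so translation by e flips every sign and
    -- the inner sum vanishes.
    set e := gfTrace d k y * g⁻¹ with he
    have heg : absTrace k (e * g) = 1 := by
      rw [he, inv_mul_cancel_right₀ hg0, absTrace_gfTrace_of_odd hK hn, hy]
    have heF : e ^ 2 ^ d = e := by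
      rw [he, mul_pow, gfTrace_pow_self hK hd, inv_pow, (hF g).1 hg]
    refine Finset.sum_involution (fun f _ => f + e) ?_ ?_ ?_ ?_
    · intro f _
      simp only [add_mul, absTrace_add, heg]
      exact negOnePow_add_one (absTrace_eq_zero_or_one k hk hK _)
    · intro f _ _ hfe
      rw [add_eq_left.1 hfe] at heg
      simp [absTrace, gfTrace_zero] at heg
    · intro f hf
      rw [hF, add_pow_char_pow, heF, (hF f).1 hf]
    · intro f _
      simp only [add_assoc, CharTwo.add_self_eq_zero, add_zero]

theorem zerosIn_eq_image [Fintype K] [DecidableEq K] (l : ℕ) {a c v₀ : K} (hv₀ : (affF l c a).eval v₀ = 0) :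
    zerosIn (affF l c a) = (kerSet (iterateFrobeniusEquiv K 2 l) a).image fun x => v₀ + x := by
  ext v
  rw [eval_affF] at hv₀
  simp only [zerosIn, Finset.mem_filter, Finset.mem_univ, true_and, Finset.mem_image, mem_kerSet,
    eval_affF]
  constructor
  · intro hv
    refine ⟨v - v₀, ?_, by ring⟩
    have := linPart_add (iterateFrobeniusEquiv K 2 l) a v₀ (v - v₀)
    rw [add_sub_cancel] at this
    linear_combination hv - hv₀ - this
  · rintro ⟨x, hx, rfl⟩
    rw [linPart_add, hx, add_zero, hv₀]

theorem card_zerosIn [Fintype K] [DecidableEq K] (l : ℕ) {a c v₀ : K} (hv₀ : (affF l c a).eval v₀ = 0) :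
    (zerosIn (affF l c a)).card = (kerSet (iterateFrobeniusEquiv K 2 l) a).card := by
  rw [zerosIn_eq_image l hv₀, Finset.card_image_of_injective _ (add_right_injective v₀)]

end Affine

/-! ### Specialisation to the Frobenius power. -/

theorem mainTheorem11 {K : Type*} [Field K] [Fintype K] [DecidableEq K]
    (k l d n : ℕ) (hl : 0 < l) (hlk : l < k) (hK : Fintype.card K = 2 ^ k)
    (hd : d = Nat.gcd l k) (hn : k = n * d)
    (GFd : Subfield K) (hGFd : Nat.card GFd = 2 ^ d)
    (c : K) (hc : c ∈ GFd) :
    (∀ a : K, ∃ v : K, (affF l c a).eval v = 0) ∧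
    (∀ a : K, (zerosIn (affF l c a)).card = 2 ^ (2 * d) →
      (∀ v : K, (affF l c a).eval v = 0 → gfTrace d k v = (n : K) * c) ∧
      (Odd n → c ≠ 0 →
        ∑ v ∈ zerosIn (affF l c a), negOnePow (absTrace k (a * (c ^ 2)⁻¹ * v ^ (2 ^ l + 1)))
          = 2 ^ d)) ∧
    (Odd n → ((setN l c (2 ^ (2 * d))).card : ℚ) = (2 ^ (k - d) - 1) / (2 ^ (2 * d) - 1)) ∧
    (Even n → ((setN l c (2 ^ (2 * d))).card : ℚ) = (2 ^ (k - d) - 2 ^ d) / (2 ^ (2 * d) - 1)) := by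
  have hchar : CharP K 2 := charP_two_of_card hK
  have h2 : (2 : K) = 0 := CharTwo.two_eq_zero
  have hd0 : 0 < d := hd ▸ Nat.gcd_pos_of_pos_left k hl
  have hdk : d ∣ k := hd ▸ Nat.gcd_dvd_right l k
  have hdl : d ∣ l := hd ▸ Nat.gcd_dvd_left l k
  have hkd : k / d = n := by rw [hn, Nat.mul_div_cancel _ hd0]
  set σ := iterateFrobeniusEquiv K 2 l with hσdef
  have hσ : ∀ x, σ x = x ^ 2 ^ l := iterateFrobeniusEquiv_def K 2 l
  have hσd : ∀ x, gfTrace d k (σ x) = gfTrace d k x := fun x => by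
    rw [hσ, gfTrace_pow_of_dvd hK hdk hdl]
  have hσ1 : ∀ x, absTrace k (σ x) = absTrace k x := fun x => by rw [hσ, absTrace_pow hK]
  have hq : (fixedSet σ).card = 2 ^ d := by
    rw [card_fixedSet_iterateFrobeniusEquiv hK, Nat.gcd_comm, ← hd]
  have hF : ∀ x, x ∈ fixedSet σ ↔ x ^ 2 ^ d = x := by
    have hsub : (Finset.univ.filter fun x : K => x ^ 2 ^ d = x) ⊆ fixedSet σ := by
      intro x hx
      rw [mem_fixedSet, hσ]
      obtain ⟨m, rfl⟩ := hdl
      have hx' := (Finset.mem_filter.1 hx).2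
      clear * - hx'
      induction m with
      | zero => simp
      | succ m ih => rw [Nat.mul_succ, pow_add, pow_mul, ih, hx']
    have heq := Finset.eq_of_subset_of_card_le hsub (by
      rw [hq, card_pow_eq_self hK, Nat.gcd_eq_right hdk])
    intro x
    rw [← heq]; simp
  have hcd : c ^ 2 ^ d = c := by
    have := Fintype.ofFinite GFd
    rw [Nat.card_eq_fintype_card] at hGFd
    have h := FiniteField.pow_card (⟨c, hc⟩ : GFd)
    rw [hGFd] at h
    exact congrArg Subtype.val h
  have hσc : σ c = c := mem_fixedSet.1 ((hF c).2 hcd)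
  have hex : ∀ a : K, ∃ v : K, (affF l c a).eval v = 0 := by
    intro a
    obtain ⟨v, hv⟩ := exists_linPart_eq hK σ hσ1 hσc a
    exact ⟨v, by rw [eval_affF, ← hσdef, hv, CharTwo.add_self_eq_zero]⟩
  have hcard : ∀ a : K, (zerosIn (affF l c a)).card = (kerSet σ a).card := by
    intro a
    obtain ⟨v, hv⟩ := hex a
    exact card_zerosIn l hv
  have hpow : 2 ^ (2 * d) = (fixedSet σ).card ^ 2 := by rw [hq, ← pow_mul, mul_comm]
  have hcount : (setN l c (2 ^ (2 * d))).card * ((2 ^ (2 * d) - 1) * 2 ^ d)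
      + 2 ^ Nat.gcd k (2 * l) = 2 ^ k := by
    -- The condition `a ≠ 0` is automatic: for `a = 0` the kernel is trivial.
    have hN : setN l c (2 ^ (2 * d))
        = Finset.univ.filter fun a => (kerSet σ a).card = (fixedSet σ).card ^ 2 := by
      ext a
      simp only [setN, Finset.mem_filter, Finset.mem_univ, true_and, hcard, hpow]
      exact ⟨fun h => h.2, fun h => ⟨ne_zero_of_card_kerSet h, h⟩⟩
    have h := card_mul_eq σ
    rw [← hN, ← hpow, hq] at h
    rw [h, ← hK, ← card_pow_eq_self hK, add_comm, ← Finset.card_univ]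
    convert Finset.card_filter_add_card_filter_not (s := Finset.univ) (fun r : K => σ (σ r) = r)
      using 3
    ext r
    simp only [Finset.mem_filter, hσ, ← pow_mul, ← pow_add, two_mul]
  have hcop : Nat.Coprime n (l / d) := by
    have := Nat.coprime_div_gcd_div_gcd (m := l) (n := k) (hd ▸ hd0)
    rw [← hd, hkd] at this
    exact this.symm
  have hgcd : Nat.gcd k (2 * l) = Nat.gcd n 2 * d := by
    have hl' : 2 * l = 2 * (l / d) * d := by rw [mul_assoc, Nat.div_mul_cancel hdl]
    rw [hn, hl', Nat.gcd_mul_right, Nat.Coprime.gcd_mul_right_cancel_right _ hcop.symm]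
  have hden : (2 ^ (2 * d) - 1 : ℚ) ≠ 0 := by
    have : (1 : ℚ) < 2 ^ (2 * d) := one_lt_pow₀ (by norm_num) (by omega)
    linarith
  have hcountQ : ((setN l c (2 ^ (2 * d))).card : ℚ) * ((2 ^ (2 * d) - 1) * 2 ^ d)
      + 2 ^ (Nat.gcd n 2 * d) = 2 ^ (k - d) * 2 ^ d := by
    rw [← pow_add, Nat.sub_add_cancel (Nat.le_of_dvd (by omega) hdk), ← hgcd]
    have h := congrArg (Nat.cast : ℕ → ℚ) hcount
    push_cast [Nat.one_le_two_pow] at h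
    exact h
  have hqQ : (2 ^ d : ℚ) ≠ 0 := by positivity
  refine ⟨hex, ?_, ?_, ?_⟩
  · intro a ha
    rw [hcard, hpow] at ha
    obtain ⟨u, w, hu, hw, hW⟩ := exists_pair σ ha
    obtain ⟨y, hy⟩ := Finite.surjective_of_injective (CharTwo.sq_injective (R := K)) (u * w)
    have hy : y ^ 2 = u * w := hy
    have hv₀ : (affF l c a).eval (c * y) = 0 := by
      rw [eval_affF, ← hσdef, linPart_smul σ a hσc, linPart_eq_one_of_sq σ hu hw hW hy, mul_one,
        CharTwo.add_self_eq_zero]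
    have hz := zerosIn_eq_image l hv₀
    rw [← hσdef] at hz
    constructor
    · intro v hv
      have hvm : v ∈ zerosIn (affF l c a) := by simp [zerosIn, hv]
      rw [hz, Finset.mem_image] at hvm
      obtain ⟨x, hx, rfl⟩ := hvm
      rw [gfTrace_add, gfTrace_eq_zero_of_linPart σ hσd (mem_kerSet.1 hx), add_zero,
        gfTrace_fixed_mul d k hcd, gfTrace_of_sq σ hσd hu hW hy, hkd, mul_comm]
    · intro hodd hc0
      have himg : zerosIn (affF l c a) = (fixedSet σ ×ˢ fixedSet σ).image
          fun p => c * (y + (p.1 * u + p.2 * w)) := by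
        -- As c is fixed by `σ`, the kernel absorbs it; every zero then carries a factor c, which
        -- cancels `(c ^ 2)⁻¹`.
        have hker : kerSet σ a = (kerSet σ a).image fun x => c * x := by
          symm
          apply Finset.eq_of_subset_of_card_le
          · intro x hx
            obtain ⟨z, hz, rfl⟩ := Finset.mem_image.1 hx
            rw [mem_kerSet] at *
            rw [linPart_smul σ a hσc, hz, mul_zero]
          · rw [Finset.card_image_of_injective _ (mul_right_injective₀ hc0)]
        rw [hz, hker, kerSet_eq_image σ hu hw hW, Finset.image_image, Finset.image_image]
        refine Finset.image_congr fun p _ => ?_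
        simp only [Function.comp_apply, mul_add]
      rw [himg, Finset.sum_image]
      · rw [← hkd] at hodd
        have hs := sum_negOnePow_mul (by omega) hK hdk hodd (fixedSet σ) hF
        rw [hq] at hs
        push_cast at hs
        rw [← hs]
        refine Finset.sum_congr rfl fun p hp => ?_
        rw [Finset.mem_product, mem_fixedSet, mem_fixedSet] at hp
        rw [← absTrace_quadratic hK σ hW hy hp.1 hp.2]
        congr 2
        rw [pow_succ (c * _), ← hσ, map_mul, hσc]
        field_simp
      · intro p hp p' hp' he
        exact injOn_combination σ hW hp hp' (add_left_cancel (mul_left_cancel₀ hc0 he))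
  · intro hodd
    have hg : Nat.gcd n 2 = 1 := Nat.coprime_two_right.2 hodd
    rw [hg, one_mul] at hcountQ
    rw [eq_div_iff hden]
    apply mul_right_cancel₀ hqQ
    linear_combination hcountQ
  · intro heven
    have hg : Nat.gcd n 2 = 2 := Nat.gcd_eq_right heven.two_dvd
    rw [hg, mul_comm 2 d, pow_mul] at hcountQ
    rw [eq_div_iff hden]
    apply mul_right_cancel₀ hqQ
    rw [mul_comm 2 d, pow_mul] at *
    linear_combination hcountQ
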